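/- Let $(\Omega,\mathcal F,\mu)$ be a complete $\sigma$-finite measure space, let $(H_\omega)_{\omega\in\Omega}$ be real Hilbert spaces, and let $\mathfrak G$ be a vector subspace of $\prod_{\omega\in\Omega}H_\omega$ such that: [A] for every $x\in\mathfrak G$, $\omega\mapsto\|x(\omega)\|$ is $\mathcal F$-measurable; [B] every $x\in\prod_{\omega}H_\omega$ for which $\omega\mapsto\langle x(\omega),y(\omega)\rangle$ is $\mathcal F$-measurable for all $y\in\mathfrak G$ lies in $\mathfrak G$; [C] there is a sequence $(e_n)_{n\in\mathbb N}$ in $\mathfrak G$ such that, for every $\omega$, the closed linear span of $\{e_n(\omega)\}_{n\in\mathbb N}$ is $H_\omega$. Let $\mathfrak H=\{x\in\mathfrak G : \int_\Omega\|x(\omega)\|^2\,\mu(d\omega)<+\infty\}$, and let $\mathcal H$ (the Hilbert direct integral) be the space of $\mu$-a.e. equivalence classes of elements of $\mathfrak H$, with scalar product $\langle x,y\rangle=\int_\Omega\langle x(\omega),y(\omega)\rangle\,\mu(d\omega)$. For a set-valued operator $B\colon E\to 2^E$ on a real Hilbert space $E$, set $\operatorname{zer}B=\{x: 0\in Bx\}$,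 $B^{-1}u=\{x:u\in Bx\}$, and $J_B=(\mathrm{Id}+B)^{-1}$. For set-valued operators $B_\omega\colon H_\omega\to2^{H_\omega}$, let $\int^\oplus B_\omega\,d\mu\colon\mathcal H\to2^{\mathcal H}$ be the operator $x\mapsto\{x^*\in\mathcal H: x^*(\omega)\in B_\omega(x(\omega))\text{ for }\mu\text{-a.e. }\omega\}$. For every $\omega\in\Omega$, let $A_\omega\colon H_\omega\to2^{H_\omega}$ be maximally monotone. Suppose that, for every $x\in\mathfrak H$, the mapping $\omega\mapsto J_{A_\omega}(x(\omega))$ lies in $\mathfrak G$, and that $A=\int^\oplus A_\omega\,d\mu$ has nonempty domain, that is, $Ax\neq\varnothing$ for some $x\in\mathcal H$. Let $G$ be a separable real Hilbert space and let $W\colon G\to2^G$ be maximally monotone. For every $\omega\in\Omega$, let $L_\omega\colon G\to H_\omega$ be linear and bounded. Suppose that, for every $z\in G$, the mapping $\mathfrak e_Lz\colon\omega\mapsto L_\omega z$ lies in $\mathfrak G$, and that $\int_\Omega\|L_\omega\|^2\,\mu(d\omega)<+\infty$. Let $Z$ be the set of solutions to the primal problem: find $z\in G$ such that $$0\in Wz+\int_\Omega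 L_\omega^*\bigl(A_\omega(L_\omega z)\bigr)\,\mu(d\omega),$$ where the integral of a set-valued mapping $X\colon\Omega\to 2^G$ is the Aumann integral $\{\int_\Omega x\,d\mu : x\colon\Omega\to G\ \text{integrable},\ x(\omega)\in X(\omega)\ \mu\text{-a.e.}\}$. Let $Z^*$ be the set of solutions to the dual problem: find $x^*\in\mathcal H$ such that there exists $z\in W^{-1}\bigl(-\int_\Omega L_\omega^*(x^*(\omega))\,\mu(d\omega)\bigr)$ with $L_\omega z\in A_\omega^{-1}(x^*(\omega))$ for $\mu$-a.e. $\omega$. Define the Kuhn–Tucker operator $K$ on $G\oplus\mathcal H$ by $$K(z,x^*)=\Bigl(Wz+\int_\Omega L_\omega^*(x^*(\omega))\,\mu(d\omega)\Bigr)\times\Bigl(-\mathfrak e_Lz+\Bigl(\int^\oplus A_\omega^{-1}\,d\mu\Bigr)x^*\Bigr)$$ and the saddle operator $S$ on $G\oplus\mathcal H\oplus\mathcal H$ by $$S(z,x,u^*)=\Bigl(Wz+\int_\Omega L_\omega^*(u^*(\omega))\,\mu(d\omega)\Bigr)\times\bigl(Ax-u^*\bigr)\times\bigl\{-\mathfrak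 e_Lz+x\bigr\}.$$ Then the following hold: (i) $K$ and $S$ are maximally monotone. (ii) $\operatorname{zer}K$ and $\operatorname{zer}S$ are closed and convex. (iii) If $(z,x^*)\in\operatorname{zer}K$, then $z\in Z$ and $x^*\in Z^*$. (iv) If $(z,x,u^*)\in\operatorname{zer}S$, then $z\in Z$ and $u^*\in Z^*$. (v) $\operatorname{zer}S\neq\varnothing\Leftrightarrow\operatorname{zer}K\neq\varnothing\Leftrightarrow Z^*\neq\varnothing\Rightarrow Z\neq\varnothing$. -/

import Mathlib

open MeasureTheory
open scoped ENNReal InnerProductSpace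

noncomputable section

namespace DirectIntegral

/-! ### Set-valued operators on a real Hilbert space -/

section SetValued

variable {E : Type*} [NormedAddCommGroup E] [InnerProductSpace ℝ E]

/-- The domain of a set-valued operator. -/
def dom (A : E → Set E) : Set E := {x | (A x).Nonempty}

/-- The set of zeros of a set-valued operator. -/
def zer (A : E → Set E) : Set E := {x | (0 : E) ∈ A x}

/-- The inverse of a set-valued operator: `x ∈ A⁻¹ u` if and only if `u ∈ A x`. -/
def inverse (A : E → Set E) : E → Set E := fun u => {x | u ∈ A x}

/-- The resolvent `(Id + A)⁻¹` of a set-valued operator, as a set-valued operator. -/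
def resolvent (A : E → Set E) : E → Set E := inverse fun p => {y | ∃ v ∈ A p, y = p + v}

/-- Monotone set-valued operators. -/
def IsMonotone (A : E → Set E) : Prop :=
  ∀ x y : E, ∀ u ∈ A x, ∀ v ∈ A y, 0 ≤ ⟪x - y, u - v⟫_ℝ

/-- A monotone operator is maximally monotone if no monotone operator has a strictly larger
graph. -/
def IsMaximallyMonotone (A : E → Set E) : Prop :=
  IsMonotone A ∧ ∀ B : E → Set E, IsMonotone B → (∀ x, A x ⊆ B x) → B = A

end SetValued

/-- The Aumann integral of a set-valued mapping: the set of the integrals of its integrable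
almost everywhere selections. -/
def aumannIntegral {Ω : Type*} [MeasurableSpace Ω] (μ : Measure Ω)
    {G : Type*} [NormedAddCommGroup G] [NormedSpace ℝ G] (X : Ω → Set G) : Set G :=
  {v | ∃ x : Ω → G, Integrable x μ ∧ (∀ᵐ ω ∂μ, x ω ∈ X ω) ∧ v = ∫ ω, x ω ∂μ}

/-! ### Measurable vector fields and their direct integrals -/

section Fields

variable {Ω : Type*} [MeasurableSpace Ω] {H : Ω → Type*}
  [∀ ω, NormedAddCommGroup (H ω)] [∀ ω, InnerProductSpace ℝ (H ω)]

variable (H) in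
/-- The vector space of measurable vector fields of a measurable vector field of real Hilbert
spaces `(H ω)`. -/
structure MeasurableField where
  /-- The vector space of all the vector fields that are declared measurable. -/
  fields : Submodule ℝ (∀ ω, H ω)
  measurable_norm : ∀ x ∈ fields, Measurable fun ω => ‖x ω‖
  mem_of_measurable_inner : ∀ x : ∀ ω, H ω,
    (∀ y ∈ fields, Measurable fun ω => ⟪x ω, y ω⟫_ℝ) → x ∈ fields
  exists_total : ∃ e : ℕ → ∀ ω, H ω, (∀ n, e n ∈ fields) ∧
    ∀ ω, closure (Submodule.span ℝ (Set.range fun n => e n ω) : Set (H ω)) = Set.univ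

variable (𝔊 : MeasurableField H) (μ : Measure Ω)

theorem measurable_inner {x y : ∀ ω, H ω} (hx : x ∈ 𝔊.fields) (hy : y ∈ 𝔊.fields) :
    Measurable fun ω => ⟪x ω, y ω⟫_ℝ := by
  have h : (fun ω => ⟪x ω, y ω⟫_ℝ) =
      fun ω => (‖(x + y) ω‖ * ‖(x + y) ω‖ - ‖x ω‖ * ‖x ω‖ - ‖y ω‖ * ‖y ω‖) / 2 := by
    funext ω
    exact real_inner_eq_norm_add_mul_self_sub_norm_mul_self_sub_norm_mul_self_div_two (x ω) (y ω)
  rw [h]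
  have h1 := 𝔊.measurable_norm _ (𝔊.fields.add_mem hx hy)
  have h2 := 𝔊.measurable_norm _ hx
  have h3 := 𝔊.measurable_norm _ hy
  exact (((h1.mul h1).sub (h2.mul h2)).sub (h3.mul h3)).div_const 2

theorem memLp_norm_iff {x : ∀ ω, H ω} (hx : x ∈ 𝔊.fields) :
    MemLp (fun ω => ‖x ω‖) 2 μ ↔ ∫⁻ ω, ‖x ω‖ₑ ^ 2 ∂μ < ∞ := by
  rw [MemLp, and_iff_right (𝔊.measurable_norm x hx).aestronglyMeasurable,
    eLpNorm_lt_top_iff_lintegral_rpow_enorm_lt_top (by norm_num) (by norm_num)]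
  simp

/-- The square-integrable measurable vector fields. -/
def squareIntegrable : Submodule ℝ (∀ ω, H ω) where
  carrier := {x | x ∈ 𝔊.fields ∧ ∫⁻ ω, ‖x ω‖ₑ ^ 2 ∂μ < ∞}
  zero_mem' := ⟨𝔊.fields.zero_mem, by simp⟩
  add_mem' := by
    rintro x y ⟨hx, hx2⟩ ⟨hy, hy2⟩
    have hxy := 𝔊.fields.add_mem hx hy
    refine ⟨hxy, ?_⟩
    rw [← memLp_norm_iff 𝔊 μ hx] at hx2
    rw [← memLp_norm_iff 𝔊 μ hy] at hy2
    rw [← memLp_norm_iff 𝔊 μ hxy]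
    refine (hx2.add hy2).mono (𝔊.measurable_norm _ hxy).aestronglyMeasurable
      (Filter.Eventually.of_forall fun ω => ?_)
    rw [norm_norm]
    exact (norm_add_le (x ω) (y ω)).trans (le_abs_self _)
  smul_mem' := by
    rintro c x ⟨hx, hx2⟩
    have hcx := 𝔊.fields.smul_mem c hx
    refine ⟨hcx, ?_⟩
    rw [← memLp_norm_iff 𝔊 μ hx] at hx2
    rw [← memLp_norm_iff 𝔊 μ hcx]
    have h : (fun ω => ‖(c • x) ω‖) = fun ω => ‖c‖ * ‖x ω‖ := by
      funext ω
      exact norm_smul c (x ω)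
    rw [h]
    exact hx2.const_mul _

/-- The square-integrable measurable vector fields that vanish almost everywhere. -/
def nullFields : Submodule ℝ (squareIntegrable 𝔊 μ) where
  carrier := {x | ∀ᵐ ω ∂μ, x.1 ω = 0}
  zero_mem' := by
    change ∀ᵐ ω ∂μ, (0 : H ω) = 0
    exact Filter.Eventually.of_forall fun _ => rfl
  add_mem' := by
    intro x y (hx : ∀ᵐ ω ∂μ, x.1 ω = 0) (hy : ∀ᵐ ω ∂μ, y.1 ω = 0)
    change ∀ᵐ ω ∂μ, x.1 ω + y.1 ω = 0
    filter_upwards [hx, hy] with ω h1 h2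
    rw [h1, h2, add_zero]
  smul_mem' := by
    intro c x (hx : ∀ᵐ ω ∂μ, x.1 ω = 0)
    change ∀ᵐ ω ∂μ, c • x.1 ω = 0
    filter_upwards [hx] with ω h1
    rw [h1, smul_zero]

/-- The Hilbert direct integral of the spaces `(H ω)` relative to `𝔊`: the square-integrable
measurable vector fields, up to equality almost everywhere. -/
def Space : Type _ := squareIntegrable 𝔊 μ ⧸ nullFields 𝔊 μ

namespace Space

instance : AddCommGroup (Space 𝔊 μ) :=
  inferInstanceAs (AddCommGroup (squareIntegrable 𝔊 μ ⧸ nullFields 𝔊 μ))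

instance : Module ℝ (Space 𝔊 μ) :=
  inferInstanceAs (Module ℝ (squareIntegrable 𝔊 μ ⧸ nullFields 𝔊 μ))

variable {𝔊 μ}

/-- The class of a square-integrable measurable vector field. -/
def mk (x : squareIntegrable 𝔊 μ) : Space 𝔊 μ := Submodule.Quotient.mk x

/-- A representative of an element of the direct integral. -/
def rep (x : Space 𝔊 μ) : squareIntegrable 𝔊 μ := Quotient.out x

/-- Elements of the direct integral are evaluated through a representative. -/
instance : CoeFun (Space 𝔊 μ) fun _ => ∀ ω, H ω := ⟨fun x => (rep x).1⟩

theorem mk_rep (x : Space 𝔊 μ) : mk (rep x) = x := Quotient.out_eq x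

theorem mk_eq_mk {x y : squareIntegrable 𝔊 μ} : mk x = mk y ↔ ∀ᵐ ω ∂μ, x.1 ω = y.1 ω := by
  refine (Submodule.Quotient.eq (nullFields 𝔊 μ)).trans ?_
  change (∀ᵐ ω ∂μ, x.1 ω - y.1 ω = 0) ↔ _
  simp only [sub_eq_zero]

theorem coeFn_mk (x : squareIntegrable 𝔊 μ) : ∀ᵐ ω ∂μ, mk x ω = x.1 ω :=
  mk_eq_mk.1 (mk_rep (mk x))

theorem coeFn_add (x y : Space 𝔊 μ) : ∀ᵐ ω ∂μ, (x + y) ω = x ω + y ω := by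
  have h : x + y = mk (rep x + rep y) := by
    conv_lhs => rw [← mk_rep x, ← mk_rep y]
    rfl
  have h' := coeFn_mk (rep x + rep y)
  rw [← h] at h'
  exact h'

theorem coeFn_smul (c : ℝ) (x : Space 𝔊 μ) : ∀ᵐ ω ∂μ, (c • x) ω = c • x ω := by
  have h : c • x = mk (c • rep x) := by
    conv_lhs => rw [← mk_rep x]
    rfl
  have h' := coeFn_mk (c • rep x)
  rw [← h] at h'
  exact h'

theorem coeFn_mem (x : Space 𝔊 μ) : (fun ω => x ω) ∈ squareIntegrable 𝔊 μ := (rep x).2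

theorem memLp_norm (x : Space 𝔊 μ) : MemLp (fun ω => ‖x ω‖) 2 μ :=
  (memLp_norm_iff 𝔊 μ (coeFn_mem x).1).2 (coeFn_mem x).2

theorem integrable_inner (x y : Space 𝔊 μ) : Integrable (fun ω => ⟪x ω, y ω⟫_ℝ) μ := by
  refine ((memLp_norm x).integrable_mul (memLp_norm y)).mono
    (measurable_inner 𝔊 (coeFn_mem x).1 (coeFn_mem y).1).aestronglyMeasurable
    (Filter.Eventually.of_forall fun ω => ?_)
  exact (norm_inner_le_norm (x ω) (y ω)).trans (le_abs_self _)

/-- The scalar product `∫ ⟪x ω, y ω⟫ dμ`. -/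
instance : Inner ℝ (Space 𝔊 μ) := ⟨fun x y => ∫ ω, ⟪x ω, y ω⟫_ℝ ∂μ⟩

theorem inner_def (x y : Space 𝔊 μ) : ⟪x, y⟫_ℝ = ∫ ω, ⟪x ω, y ω⟫_ℝ ∂μ := rfl

variable (𝔊 μ) in
/-- The axioms of a scalar product. -/
@[reducible]
def core : InnerProductSpace.Core ℝ (Space 𝔊 μ) where
  conj_inner_symm x y := by
    simp only [inner_def, conj_trivial]
    exact integral_congr_ae (Filter.Eventually.of_forall fun ω => real_inner_comm _ _)
  re_inner_nonneg x := by
    simp only [inner_def, RCLike.re_to_real]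
    exact integral_nonneg fun ω => real_inner_self_nonneg
  add_left x y z := by
    simp only [inner_def]
    rw [← integral_add (integrable_inner x z) (integrable_inner y z)]
    refine integral_congr_ae ?_
    filter_upwards [coeFn_add x y] with ω h
    rw [h, inner_add_left]
  smul_left x y c := by
    simp only [inner_def, conj_trivial]
    rw [← integral_const_mul]
    refine integral_congr_ae ?_
    filter_upwards [coeFn_smul c x] with ω h
    rw [h, real_inner_smul_left]
  definite x hx := by
    rw [inner_def, integral_eq_zero_iff_of_nonneg (fun ω => real_inner_self_nonneg)
      (integrable_inner x x)] at hx
    rw [← mk_rep x]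
    change _ = mk 0
    rw [mk_eq_mk]
    filter_upwards [hx] with ω h
    exact inner_self_eq_zero.1 h

instance : NormedAddCommGroup (Space 𝔊 μ) :=
  @InnerProductSpace.Core.toNormedAddCommGroup ℝ (Space 𝔊 μ) _ _ _ (core 𝔊 μ)

instance : InnerProductSpace ℝ (Space 𝔊 μ) := InnerProductSpace.ofCore (core 𝔊 μ).toCore

end Space

/-- The Hilbert direct integral of a family of set-valued operators. -/
def operatorIntegral (A : ∀ ω, H ω → Set (H ω)) : Space 𝔊 μ → Set (Space 𝔊 μ) :=
  fun x => {u | ∀ᵐ ω ∂μ, u ω ∈ A ω (x ω)}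

/-! ### Linearly composed operators -/

variable {𝔊 μ} {G : Type*} [NormedAddCommGroup G] [InnerProductSpace ℝ G]

theorem evaluation_mem (L : ∀ ω, G →L[ℝ] H ω) (hL : ∀ z, (fun ω => L ω z) ∈ 𝔊.fields)
    (hL2 : ∫⁻ ω, ‖L ω‖ₑ ^ 2 ∂μ < ∞) (z : G) :
    (fun ω => L ω z) ∈ squareIntegrable 𝔊 μ := by
  refine ⟨hL z, ?_⟩
  calc ∫⁻ ω, ‖L ω z‖ₑ ^ 2 ∂μ ≤ ∫⁻ ω, ‖L ω‖ₑ ^ 2 * ‖z‖ₑ ^ 2 ∂μ := by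
        refine lintegral_mono fun ω => ?_
        rw [← mul_pow]
        gcongr
        exact (L ω).le_opENorm z
    _ = (∫⁻ ω, ‖L ω‖ₑ ^ 2 ∂μ) * ‖z‖ₑ ^ 2 := lintegral_mul_const' _ _ (by finiteness)
    _ < ∞ := ENNReal.mul_lt_top hL2 (by finiteness)

/-- The class in the direct integral of the vector field `ω ↦ L ω z`. -/
def evaluation (L : ∀ ω, G →L[ℝ] H ω) (hL : ∀ z, (fun ω => L ω z) ∈ 𝔊.fields)
    (hL2 : ∫⁻ ω, ‖L ω‖ₑ ^ 2 ∂μ < ∞) (z : G) : Space 𝔊 μ :=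
  Space.mk ⟨fun ω => L ω z, evaluation_mem L hL hL2 z⟩

variable [CompleteSpace G] [∀ ω, CompleteSpace (H ω)]

/-- The vector field `ω ↦ (L ω)* (x ω)` is integrable, so that its integral is the true one. -/
theorem integrable_adjoint [TopologicalSpace.SeparableSpace G] (L : ∀ ω, G →L[ℝ] H ω)
    (hL : ∀ z, (fun ω => L ω z) ∈ 𝔊.fields) (hL2 : ∫⁻ ω, ‖L ω‖ₑ ^ 2 ∂μ < ∞) (x : Space 𝔊 μ) :
    Integrable (fun ω => (L ω).adjoint (x ω)) μ := by
  have hw : ∀ z : G, Measurable fun ω => ⟪z, (L ω).adjoint (x ω)⟫_ℝ := by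
    intro z
    simp only [ContinuousLinearMap.adjoint_inner_right]
    exact measurable_inner 𝔊 (hL z) (Space.coeFn_mem x).1
  have hm : StronglyMeasurable fun ω => (L ω).adjoint (x ω) := by
    obtain ⟨s, b, hb⟩ := exists_hilbertBasis ℝ G
    have hs : Countable s := by
      have : Pairwise fun i j : s => 1 ≤ dist (b i) (b j) := by
        intro i j hij
        have h := b.orthonormal
        have h2 : dist (b i) (b j) ^ 2 = 2 := by
          rw [dist_eq_norm, @norm_sub_sq ℝ, h.1 i, h.1 j, h.2 hij]
          norm_num
        nlinarith [dist_nonneg (x := b i) (y := b j)]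
      refine Pairwise.countable_of_isOpen_disjoint (s := fun i => Metric.ball (b i) (1 / 2))
        (fun i j hij => Metric.ball_disjoint_ball (by norm_num; exact this hij))
        (fun i => Metric.isOpen_ball) (fun i => ⟨b i, Metric.mem_ball_self (by norm_num)⟩)
    refine stronglyMeasurable_of_tendsto (Filter.atTop : Filter (Finset s))
      (f := fun t ω => ∑ i ∈ t, ⟪b i, (L ω).adjoint (x ω)⟫_ℝ • b i) (fun t => ?_) ?_
    · exact Finset.stronglyMeasurable_fun_sum t fun i _ =>
        ((hw (b i)).stronglyMeasurable.smul_const (b i))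
    · rw [tendsto_pi_nhds]
      intro ω
      have h := b.hasSum_repr ((L ω).adjoint (x ω))
      simp only [b.repr_apply_apply] at h
      exact h
  have hx := Space.memLp_norm x
  refine ⟨hm.aestronglyMeasurable, ?_⟩
  have hxn : AEMeasurable (fun ω => ‖x ω‖ₑ ^ 2) μ :=
    ((𝔊.measurable_norm _ (Space.coeFn_mem x).1).enorm.pow_const 2).aemeasurable.congr
      (Filter.Eventually.of_forall fun ω => by simp)
  calc ∫⁻ ω, ‖(L ω).adjoint (x ω)‖ₑ ∂μ ≤ ∫⁻ ω, (‖L ω‖ₑ ^ 2 + ‖x ω‖ₑ ^ 2) ∂μ := by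
        refine lintegral_mono fun ω => ?_
        have h1 : ‖(L ω).adjoint (x ω)‖ ≤ ‖L ω‖ * ‖x ω‖ := by
          simpa using ((L ω).adjoint).le_opNorm (x ω)
        have h2 : ‖(L ω).adjoint (x ω)‖ ≤ ‖L ω‖ ^ 2 + ‖x ω‖ ^ 2 := by
          nlinarith [sq_nonneg (‖L ω‖ - ‖x ω‖), sq_nonneg (‖L ω‖), sq_nonneg (‖x ω‖)]
        have h3 := ENNReal.ofReal_le_ofReal h2
        rw [ENNReal.ofReal_add (by positivity) (by positivity),
          ENNReal.ofReal_pow (norm_nonneg _), ENNReal.ofReal_pow (norm_nonneg _)] at h3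
        simpa only [ofReal_norm] using h3
    _ = (∫⁻ ω, ‖L ω‖ₑ ^ 2 ∂μ) + ∫⁻ ω, ‖x ω‖ₑ ^ 2 ∂μ := lintegral_add_right' _ hxn
    _ < ∞ := ENNReal.add_lt_top.2 ⟨hL2, (Space.coeFn_mem x).2⟩

/-- The integral `∫ (L ω)* (x ω) dμ`. -/
def adjointIntegral (L : ∀ ω, G →L[ℝ] H ω) (x : Space 𝔊 μ) : G :=
  ∫ ω, (L ω).adjoint (x ω) ∂μ

variable (μ) in
/-- The set of solutions of the primal problem `0 ∈ W z + ∫ (L ω)* (A ω (L ω z)) dμ`. -/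
def primalSolutions (W : G → Set G) (A : ∀ ω, H ω → Set (H ω)) (L : ∀ ω, G →L[ℝ] H ω) : Set G :=
  {z | ∃ w ∈ W z, ∃ v ∈ aumannIntegral μ (fun ω => (L ω).adjoint '' A ω (L ω z)), 0 = w + v}

variable (𝔊 μ) in
/-- The set of solutions of the dual problem. -/
def dualSolutions (W : G → Set G) (A : ∀ ω, H ω → Set (H ω)) (L : ∀ ω, G →L[ℝ] H ω) :
    Set (Space 𝔊 μ) :=
  {x | ∃ z ∈ inverse W (-adjointIntegral L x), ∀ᵐ ω ∂μ, L ω z ∈ inverse (A ω) (x ω)}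

/-- The Kuhn–Tucker operator on the Hilbert direct sum of `G` and the direct integral. -/
def kuhnTucker (W : G → Set G) (A : ∀ ω, H ω → Set (H ω)) (L : ∀ ω, G →L[ℝ] H ω)
    (hL : ∀ z, (fun ω => L ω z) ∈ 𝔊.fields) (hL2 : ∫⁻ ω, ‖L ω‖ₑ ^ 2 ∂μ < ∞) :
    WithLp 2 (G × Space 𝔊 μ) → Set (WithLp 2 (G × Space 𝔊 μ)) :=
  fun p => {q |
    (∃ w ∈ W p.fst, q.fst = w + adjointIntegral L p.snd) ∧
    (∃ u ∈ operatorIntegral 𝔊 μ (fun ω => inverse (A ω)) p.snd,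
      q.snd = -evaluation L hL hL2 p.fst + u)}

/-- The saddle operator on the Hilbert direct sum of `G` and two copies of the direct integral. -/
def saddle (W : G → Set G) (A : ∀ ω, H ω → Set (H ω)) (L : ∀ ω, G →L[ℝ] H ω)
    (hL : ∀ z, (fun ω => L ω z) ∈ 𝔊.fields) (hL2 : ∫⁻ ω, ‖L ω‖ₑ ^ 2 ∂μ < ∞) :
    WithLp 2 (G × WithLp 2 (Space 𝔊 μ × Space 𝔊 μ)) →
      Set (WithLp 2 (G × WithLp 2 (Space 𝔊 μ × Space 𝔊 μ))) :=
  fun p => {q |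
    (∃ w ∈ W p.fst, q.fst = w + adjointIntegral L p.snd.snd) ∧
    (∃ u ∈ operatorIntegral 𝔊 μ A p.snd.fst, q.snd.fst = u - p.snd.snd) ∧
    q.snd.snd = -evaluation L hL hL2 p.fst + p.snd.fst}

end Fields

end DirectIntegral

end

/-! Each of the Kuhn–Tucker and saddle operators is a product of maximally monotone operators plus a
skew mapping: `W` and the inverse of the integral of `A` for the first, `W`, the integral of `A` and
the zero operator for the second. The skewness comes from `inner_adjointIntegral`, which exhibits
`adjointIntegral` as the adjoint of `evaluation`. Products and skew perturbations preserve
maximality, and the zeros of a maximally monotone operator form an intersection of closed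
half-spaces.

The analytic core is the maximality of the integral of `A`. By the easy half of Minty's theorem it
suffices to solve `x = p + v` with `v` in the image of `p`. The full theorem solves this in every
fibre, the hypothesis on resolvents makes the solution a measurable field, and nonexpansiveness
relative to a point of the domain makes it square-integrable.

The solution claims are then algebra: a zero of the Kuhn–Tucker operator is exactly a dual solution
paired with its witness `z`, and the dual field supplies the Aumann selection required of `z`. -/

namespace DirectIntegral

/-! ### Maximal monotonicity: characterization, stability and zeros. -/

section Monotone

variable {E : Type*} [NormedAddCommGroup E] [InnerProductSpace ℝ E]

/-- Adjoining `(x, u)` to the graph keeps it monotone, so maximality says that nothing was added. -/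
theorem IsMaximallyMonotone.mem_of_related {A : E → Set E} (hA : IsMaximallyMonotone A) {x u : E}
    (h : ∀ y, ∀ v ∈ A y, 0 ≤ ⟪x - y, u - v⟫_ℝ) : u ∈ A x := by
  have hB : IsMonotone fun y => A y ∪ {v | y = x ∧ v = u} := by
    rintro y z v (hv | ⟨rfl, rfl⟩) w (hw | ⟨rfl, rfl⟩)
    · exact hA.1 y z v hv w hw
    · rw [← neg_sub, ← neg_sub w v, inner_neg_neg]
      exact h y v hv
    · exact h z w hw
    · simp
  rw [← hA.2 _ hB fun y => Set.subset_union_left]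
  exact Or.inr ⟨rfl, rfl⟩

theorem isMaximallyMonotone_of_related {A : E → Set E} (hA : IsMonotone A)
    (h : ∀ x u, (∀ y, ∀ v ∈ A y, 0 ≤ ⟪x - y, u - v⟫_ℝ) → u ∈ A x) : IsMaximallyMonotone A := by
  refine ⟨hA, fun B hB hAB => funext fun x => Set.Subset.antisymm (fun u hu => ?_) (hAB x)⟩
  exact h x u fun y v hv => hB x y u hu v (hAB y hv)

/-- The easy half of Minty's theorem. -/
theorem isMaximallyMonotone_of_surjective {A : E → Set E} (hA : IsMonotone A)
    (h : ∀ x, ∃ p, ∃ v ∈ A p, x = p + v) : IsMaximallyMonotone A := by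
  refine isMaximallyMonotone_of_related hA fun x u hxu => ?_
  obtain ⟨p, v, hv, hp⟩ := h (x + u)
  have h1 := hxu p v hv
  have h2 : u - v = -(x - p) := by
    rw [eq_sub_of_add_eq' hp]; abel
  rw [h2, inner_neg_right, real_inner_self_eq_norm_sq] at h1
  have h3 : x = p := sub_eq_zero.1 (norm_eq_zero.1 (by nlinarith [norm_nonneg (x - p)]))
  subst h3
  rwa [add_left_cancel hp]

theorem IsMaximallyMonotone.inverse {A : E → Set E} (hA : IsMaximallyMonotone A) :
    IsMaximallyMonotone (inverse A) := by
  refine isMaximallyMonotone_of_related (fun x y u hu v hv => ?_) fun x u h => ?_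
  · rw [real_inner_comm]
    exact hA.1 u v x hu y hv
  · refine hA.mem_of_related fun y v hv => ?_
    rw [real_inner_comm]
    exact h v y hv

theorem isMaximallyMonotone_zero : IsMaximallyMonotone fun _ : E => ({0} : Set E) := by
  refine isMaximallyMonotone_of_related ?_ fun x u h => ?_
  · rintro x y u rfl v rfl
    simp
  · have h1 := h (x + u) 0 rfl
    rw [sub_add_cancel_left, sub_zero, inner_neg_left, real_inner_self_eq_norm_sq] at h1
    exact norm_eq_zero.1 (by nlinarith [norm_nonneg u])

/-- If the first component failed, some graph point of `A` would give a negative pairing. The second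
component would then be related to all of `B`, hence lie in its graph, and testing it against itself
isolates that negative pairing. -/
theorem IsMaximallyMonotone.prod {F : Type*} [NormedAddCommGroup F] [InnerProductSpace ℝ F]
    {A : E → Set E} {B : F → Set F} (hA : IsMaximallyMonotone A) (hB : IsMaximallyMonotone B) :
    IsMaximallyMonotone fun p : WithLp 2 (E × F) =>
      {q : WithLp 2 (E × F) | q.fst ∈ A p.fst ∧ q.snd ∈ B p.snd} := by
  refine isMaximallyMonotone_of_related (fun x y u hu v hv => ?_) fun x u h => ?_
  · rw [WithLp.prod_inner_apply]
    exact add_nonneg (hA.1 _ _ _ hu.1 _ hv.1) (hB.1 _ _ _ hu.2 _ hv.2)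
  · have h' : ∀ y, ∀ v ∈ A y, ∀ z, ∀ w ∈ B z,
        0 ≤ ⟪x.fst - y, u.fst - v⟫_ℝ + ⟪x.snd - z, u.snd - w⟫_ℝ := by
      intro y v hv z w hw
      have := h (WithLp.toLp 2 (y, z)) (WithLp.toLp 2 (v, w)) ⟨hv, hw⟩
      rwa [WithLp.prod_inner_apply] at this
    have h1 : u.fst ∈ A x.fst := by
      by_contra hn
      obtain ⟨y, v, hv, hlt⟩ : ∃ y, ∃ v ∈ A y, ⟪x.fst - y, u.fst - v⟫_ℝ < 0 := by
        by_contra! hc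
        exact hn (hA.mem_of_related hc)
      have h2 : u.snd ∈ B x.snd :=
        hB.mem_of_related fun z w hw => by linarith [h' y v hv z w hw]
      have h3 := h' y v hv _ _ h2
      rw [sub_self x.snd, inner_zero_left] at h3
      linarith
    refine ⟨h1, hB.mem_of_related fun z w hw => ?_⟩
    simpa using h' _ _ h1 z w hw

/-- Maximal monotonicity is preserved when a skew mapping is added. -/
theorem IsMaximallyMonotone.add_skew {A : E → Set E} (hA : IsMaximallyMonotone A) (S : E → E)
    (hS : ∀ x y, ⟪x - y, S x - S y⟫_ℝ = 0) : IsMaximallyMonotone fun x => {u | u - S x ∈ A x} := by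
  have key : ∀ x y u v, ⟪x - y, u - v⟫_ℝ = ⟪x - y, (u - S x) - (v - S y)⟫_ℝ := by
    intro x y u v
    rw [show u - v = ((u - S x) - (v - S y)) + (S x - S y) by abel, inner_add_right, hS, add_zero]
  refine isMaximallyMonotone_of_related (fun x y u hu v hv => ?_) fun x u h => ?_
  · rw [key]
    exact hA.1 _ _ _ hu _ hv
  · refine hA.mem_of_related fun y v hv => ?_
    have h1 := h y (v + S y) (by simpa using hv)
    rwa [key, add_sub_cancel_right] at h1

/-- With `u = 0`, being related to a graph point `(y, v)` is a closed half-space condition on `x`;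
closedness and convexity follow at once. -/
theorem IsMaximallyMonotone.zer_eq {A : E → Set E} (hA : IsMaximallyMonotone A) :
    zer A = ⋂ y, ⋂ v ∈ A y, {x | ⟪x, v⟫_ℝ ≤ ⟪y, v⟫_ℝ} := by
  have key : ∀ x y v : E, 0 ≤ ⟪x - y, 0 - v⟫_ℝ ↔ ⟪x, v⟫_ℝ ≤ ⟪y, v⟫_ℝ := by
    intro x y v
    rw [zero_sub, inner_neg_right, inner_sub_left, neg_sub, sub_nonneg]
  ext x
  simp only [Set.mem_iInter, Set.mem_ofPred_eq, ← key]
  exact ⟨fun h y v hv => hA.1 x y 0 h v hv, fun h => hA.mem_of_related h⟩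

theorem IsMaximallyMonotone.isClosed_zer {A : E → Set E} (hA : IsMaximallyMonotone A) :
    IsClosed (zer A) := by
  rw [hA.zer_eq]
  exact isClosed_iInter fun y => isClosed_iInter fun v => isClosed_iInter fun _ =>
    isClosed_le (by fun_prop) (by fun_prop)

theorem IsMaximallyMonotone.convex_zer {A : E → Set E} (hA : IsMaximallyMonotone A) :
    Convex ℝ (zer A) := by
  rw [hA.zer_eq]
  refine convex_iInter fun y => convex_iInter fun v => convex_iInter fun _ => ?_
  exact convex_halfSpace_le
    ⟨fun a b => inner_add_left a b v, fun c a => real_inner_smul_left a v c⟩ _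

end Monotone

/-! ### Minty's theorem via the Fitzpatrick function. -/

section Minty

variable {E : Type*} [NormedAddCommGroup E] [InnerProductSpace ℝ E]

/-- A closed convex epigraph on which `t + ‖z‖² / 2` is bounded below contains a minimizer. -/
theorem exists_minimizer_add_norm_sq [CompleteSpace E] {C : Set (E × ℝ)} (hne : C.Nonempty)
    (hcl : IsClosed C) (hcv : Convex ℝ C) (hbd : ∀ p ∈ C, 0 ≤ p.2 + ‖p.1‖ ^ 2 / 2) :
    ∃ p ∈ C, ∀ q ∈ C, p.2 + ‖p.1‖ ^ 2 / 2 ≤ q.2 + ‖q.1‖ ^ 2 / 2 := by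
  set f : E × ℝ → ℝ := fun p => p.2 + ‖p.1‖ ^ 2 / 2 with hf
  have hbb : BddBelow (f '' C) := ⟨0, by rintro _ ⟨p, hp, rfl⟩; exact hbd p hp⟩
  set m := sInf (f '' C) with hm
  have hle : ∀ p ∈ C, m ≤ f p := fun p hp => csInf_le hbb ⟨p, hp, rfl⟩
  have hseq : ∀ n : ℕ, ∃ p ∈ C, f p < m + 1 / ((n : ℝ) + 1) := by
    intro n
    obtain ⟨_, ⟨p, hp, rfl⟩, h⟩ := exists_lt_of_csInf_lt (hne.image f)
      (show m < m + 1 / ((n : ℝ) + 1) from lt_add_of_pos_right _ (by positivity))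
    exact ⟨p, hp, h⟩
  choose p hpC hp using hseq
  -- The midpoint stays in `C`, so the parallelogram law makes a minimizing sequence Cauchy.
  have hpar : ∀ i j, ‖(p i).1 - (p j).1‖ ^ 2 ≤
      4 * (1 / ((i : ℝ) + 1) + 1 / ((j : ℝ) + 1)) := by
    intro i j
    have h1 := hle _ (hcv (hpC i) (hpC j) (by norm_num : (0 : ℝ) ≤ 1 / 2)
      (by norm_num : (0 : ℝ) ≤ 1 / 2) (by norm_num))
    have h2 := parallelogram_law_with_norm ℝ (p i).1 (p j).1
    have h3 := hp i
    have h4 := hp j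
    simp only [hf, Prod.fst_add, Prod.snd_add, Prod.smul_fst, Prod.smul_snd, ← smul_add,
      norm_smul, smul_eq_mul, Real.norm_eq_abs] at h1 h3 h4
    rw [abs_of_pos (by norm_num : (0 : ℝ) < 1 / 2)] at h1
    nlinarith
  have hlim0 := tendsto_one_div_add_atTop_nhds_zero_nat (𝕜 := ℝ)
  have hcau : CauchySeq fun n => (p n).1 := by
    refine Metric.cauchySeq_iff.2 fun ε hε => ?_
    have hev := (hlim0.eventually_lt_const (show (0 : ℝ) < ε ^ 2 / 8 by positivity))
    obtain ⟨N, hN⟩ := Filter.eventually_atTop.1 hev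
    refine ⟨N, fun i hi j hj => ?_⟩
    rw [dist_eq_norm]
    refine lt_of_pow_lt_pow_left₀ 2 hε.le ?_
    linarith [hpar i j, hN i hi, hN j hj]
  obtain ⟨z, hz⟩ := cauchySeq_tendsto_of_complete hcau
  have hfm : Filter.Tendsto (fun n => f (p n)) Filter.atTop (nhds m) := by
    refine tendsto_of_tendsto_of_tendsto_of_le_of_le tendsto_const_nhds ?_
      (fun n => hle _ (hpC n)) (fun n => (hp n).le)
    simpa using hlim0.const_add m
  have ht : Filter.Tendsto (fun n => (p n).2) Filter.atTop (nhds (m - ‖z‖ ^ 2 / 2)) := by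
    have := hfm.sub ((hz.norm.pow 2).div_const 2)
    simpa [hf] using this
  refine ⟨(z, m - ‖z‖ ^ 2 / 2), hcl.mem_of_tendsto (hz.prodMk_nhds ht)
    (Filter.Eventually.of_forall hpC), fun q hq => ?_⟩
  simpa using hle q hq

/-- Fermat's rule for a minimizer of `t + ‖z‖² / 2` over a convex set. -/
theorem le_add_inner_of_minimizer {C : Set (E × ℝ)} (hcv : Convex ℝ C) {p q : E × ℝ}
    (hp : p ∈ C) (hmin : ∀ q ∈ C, p.2 + ‖p.1‖ ^ 2 / 2 ≤ q.2 + ‖q.1‖ ^ 2 / 2) (hq : q ∈ C) :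
    p.2 ≤ q.2 + ⟪p.1, q.1 - p.1⟫_ℝ := by
  by_contra! hlt
  -- Compare `p` with the point at parameter `s` of the segment to `q`, divide by `s`, then let `s`
  -- tend to `0`.
  have h : ∀ s : ℝ, 0 < s → s ≤ 1 →
      0 ≤ q.2 - p.2 + ⟪p.1, q.1 - p.1⟫_ℝ + s * (‖q.1 - p.1‖ ^ 2 / 2) := by
    intro s hs hs1
    have h1 := hmin _ (hcv.add_smul_sub_mem hp hq ⟨hs.le, hs1⟩)
    simp only [Prod.fst_add, Prod.snd_add, Prod.smul_fst, Prod.smul_snd, Prod.fst_sub,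
      Prod.snd_sub, smul_eq_mul] at h1
    rw [norm_add_sq_real, real_inner_smul_right, norm_smul, mul_pow, Real.norm_eq_abs,
      sq_abs] at h1
    have h2 : 0 ≤ s * (q.2 - p.2 + ⟪p.1, q.1 - p.1⟫_ℝ + s * (‖q.1 - p.1‖ ^ 2 / 2)) := by
      nlinarith
    exact nonneg_of_mul_nonneg_right h2 hs
  have hc : Filter.Tendsto
      (fun s : ℝ => q.2 - p.2 + ⟪p.1, q.1 - p.1⟫_ℝ + s * (‖q.1 - p.1‖ ^ 2 / 2))
      (nhdsWithin 0 (Set.Ioi 0)) (nhds (q.2 - p.2 + ⟪p.1, q.1 - p.1⟫_ℝ +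
        0 * (‖q.1 - p.1‖ ^ 2 / 2))) :=
    (Continuous.tendsto (by fun_prop) 0).mono_left nhdsWithin_le_nhds
  have h0 := ge_of_tendsto hc (Filter.eventually_of_mem
    (Ioc_mem_nhdsGT (zero_lt_one : (0 : ℝ) < 1)) fun s hs => h s hs.1 hs.2)
  linarith

/-- Minty's theorem at the origin, by minimizing the sum of the Fitzpatrick function and of half
the squared norm. -/
theorem IsMaximallyMonotone.exists_neg_mem [CompleteSpace E] {A : E → Set E}
    (hA : IsMaximallyMonotone A) : ∃ p, -p ∈ A p := by
  -- The epigraph of the Fitzpatrick function; using it as a set avoids infinite values.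
  set C : Set (WithLp 2 (E × E) × ℝ) := {p | ∀ y, ∀ v ∈ A y,
    ⟪p.1.fst, v⟫_ℝ + ⟪y, p.1.snd⟫_ℝ - ⟪y, v⟫_ℝ ≤ p.2} with hC
  have hgr : ∀ y, ∀ v ∈ A y, ((WithLp.toLp 2 (y, v), ⟪y, v⟫_ℝ) : WithLp 2 (E × E) × ℝ) ∈ C := by
    intro y v hv z w hw
    have h := hA.1 y z v hv w hw
    rw [inner_sub_left, inner_sub_right, inner_sub_right] at h
    change ⟪y, w⟫_ℝ + ⟪z, v⟫_ℝ - ⟪z, w⟫_ℝ ≤ ⟪y, v⟫_ℝ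
    linarith
  -- Below the pairing, the point would be related to the whole graph, hence belong to it, and its
  -- own constraint gives a contradiction.
  have hge : ∀ p ∈ C, ⟪p.1.fst, p.1.snd⟫_ℝ ≤ p.2 := by
    intro p hp
    by_contra! hlt
    have h1 : p.1.snd ∈ A p.1.fst := by
      refine hA.mem_of_related fun y v hv => ?_
      rw [inner_sub_left, inner_sub_right, inner_sub_right]
      linarith [hp y v hv]
    have h2 := hp _ _ h1
    linarith
  have hnsq : ∀ z : WithLp 2 (E × E), ‖z‖ ^ 2 = ‖z.fst‖ ^ 2 + ‖z.snd‖ ^ 2 :=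
    fun z => WithLp.prod_norm_sq_eq_of_L2 z
  have hne : C.Nonempty := by
    by_contra hn
    have hem : ∀ y v, v ∉ A y := fun y v hv => hn ⟨_, hgr y v hv⟩
    exact hem 0 0 (hA.mem_of_related fun y v hv => absurd hv (hem y v))
  have hcl : IsClosed C := by
    simp only [hC, Set.ofPred_forall]
    exact isClosed_iInter fun y => isClosed_iInter fun v => isClosed_iInter fun _ =>
      isClosed_le (by fun_prop) (by fun_prop)
  have hcv : Convex ℝ C := by
    intro p hp q hq a b ha hb hab y v hv
    have h1 := mul_le_mul_of_nonneg_left (hp y v hv) ha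
    have h2 := mul_le_mul_of_nonneg_left (hq y v hv) hb
    simp only [Prod.fst_add, Prod.snd_add, Prod.smul_fst, Prod.smul_snd, smul_eq_mul,
      WithLp.add_fst, WithLp.add_snd, WithLp.smul_fst, WithLp.smul_snd, inner_add_left,
      inner_add_right, real_inner_smul_left, real_inner_smul_right]
    have h3 : ⟪y, v⟫_ℝ = a * ⟪y, v⟫_ℝ + b * ⟪y, v⟫_ℝ := by rw [← add_mul, hab, one_mul]
    linarith
  have hbd : ∀ p ∈ C, 0 ≤ p.2 + ‖p.1‖ ^ 2 / 2 := by
    intro p hp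
    rw [hnsq]
    nlinarith [hge p hp, norm_add_sq_real p.1.fst p.1.snd, sq_nonneg ‖p.1.fst + p.1.snd‖]
  obtain ⟨p, hp, hmin⟩ := exists_minimizer_add_norm_sq hne hcl hcv hbd
  set x := p.1.fst with hx
  set u := p.1.snd with hu
  -- Fermat's rule at the minimizer, combined with `⟪x, u⟫ ≤ p.2`, shows that the swapped point
  -- `(-u, -x)` is related to the graph with a margin `‖x + u‖ ^ 2`. Testing it against itself then
  -- forces `x = -u`.
  have key : ∀ y, ∀ v ∈ A y, ‖x + u‖ ^ 2 ≤ ⟪-u - y, -x - v⟫_ℝ := by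
    intro y v hv
    have h1 := le_add_inner_of_minimizer hcv hp hmin (hgr y v hv)
    rw [inner_sub_right, real_inner_self_eq_norm_sq, hnsq, WithLp.prod_inner_apply] at h1
    change p.2 ≤ ⟪y, v⟫_ℝ + (⟪x, y⟫_ℝ + ⟪u, v⟫_ℝ - (‖x‖ ^ 2 + ‖u‖ ^ 2)) at h1
    have h2 : ⟪x, u⟫_ℝ ≤ p.2 := hge p hp
    rw [norm_add_sq_real, inner_sub_left, inner_sub_right, inner_sub_right, inner_neg_neg,
      inner_neg_left, inner_neg_right, real_inner_comm x u, real_inner_comm x y]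
    linarith
  have hmem : -x ∈ A (-u) := hA.mem_of_related fun y v hv => (sq_nonneg _).trans (key y v hv)
  have h0 := key _ _ hmem
  rw [sub_self, inner_zero_left] at h0
  have hxu : x + u = 0 := norm_eq_zero.1 (by nlinarith [norm_nonneg (x + u)])
  rw [← eq_neg_of_add_eq_zero_left hxu] at hmem
  exact ⟨x, hmem⟩

/-- Minty's theorem: the resolvent of a maximally monotone operator is defined everywhere. -/
theorem IsMaximallyMonotone.resolvent_nonempty [CompleteSpace E] {A : E → Set E}
    (hA : IsMaximallyMonotone A) (x : E) : (resolvent A x).Nonempty := by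
  have hB : IsMaximallyMonotone fun p => {u | u + x ∈ A p} := by
    refine isMaximallyMonotone_of_related (fun p q u hu v hv => ?_) fun p u h => ?_
    · simpa using hA.1 p q _ hu _ hv
    · refine hA.mem_of_related fun q v hv => ?_
      have := h q (v - x) (by simpa using hv)
      rwa [show u - (v - x) = u + x - v by abel] at this
  obtain ⟨p, hp⟩ := hB.exists_neg_mem
  exact ⟨p, -p + x, hp, by abel⟩

/-- Since `z` is a resolvent of `z + w`, this is nonexpansiveness of the resolvent. -/
theorem IsMonotone.norm_resolvent_sub_le {A : E → Set E} (hA : IsMonotone A) {x p z w : E}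
    (hp : p ∈ resolvent A x) (hw : w ∈ A z) : ‖p - z‖ ≤ ‖x - (z + w)‖ := by
  obtain ⟨v, hv, rfl⟩ := hp
  have h1 := hA p z v hv w hw
  have h2 : ‖p + v - (z + w)‖ ^ 2 =
      ‖p - z‖ ^ 2 + 2 * ⟪p - z, v - w⟫_ℝ + ‖v - w‖ ^ 2 := by
    rw [← norm_add_sq_real, add_sub_add_comm]
  exact le_of_sq_le_sq (by nlinarith [sq_nonneg ‖v - w‖]) (norm_nonneg _)

end Minty

/-! ### Maximality of the direct integral of operators. -/

section Fields

variable {Ω : Type*} [MeasurableSpace Ω] {H : Ω → Type*}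
  [∀ ω, NormedAddCommGroup (H ω)] [∀ ω, InnerProductSpace ℝ (H ω)]
  {𝔊 : MeasurableField H} {μ : Measure Ω}

theorem Space.real_inner_eq (x y : Space 𝔊 μ) : ⟪x, y⟫_ℝ = ∫ ω, ⟪x ω, y ω⟫_ℝ ∂μ := rfl

theorem Space.coeFn_sub (x y : Space 𝔊 μ) : ∀ᵐ ω ∂μ, (x - y) ω = x ω - y ω := by
  filter_upwards [Space.coeFn_add x ((-1 : ℝ) • y), Space.coeFn_smul (-1) y] with ω h1 h2
  rw [neg_one_smul] at h1 h2
  rw [sub_eq_add_neg, h1, h2, neg_one_smul, sub_eq_add_neg]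

theorem isMonotone_operatorIntegral {A : ∀ ω, H ω → Set (H ω)} (hA : ∀ ω, IsMonotone (A ω)) :
    IsMonotone (operatorIntegral 𝔊 μ A) := by
  intro x y u hu v hv
  rw [Space.real_inner_eq]
  refine integral_nonneg_of_ae ?_
  filter_upwards [hu, hv, Space.coeFn_sub x y, Space.coeFn_sub u v] with ω h1 h2 h3 h4
  rw [h3, h4]
  exact hA ω _ _ _ h1 _ h2

theorem isMaximallyMonotone_operatorIntegral [∀ ω, CompleteSpace (H ω)]
    {A : ∀ ω, H ω → Set (H ω)} (hA : ∀ ω, IsMaximallyMonotone (A ω))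
    (hJ : ∀ x ∈ squareIntegrable 𝔊 μ, ∀ p : ∀ ω, H ω,
      (∀ ω, p ω ∈ resolvent (A ω) (x ω)) → p ∈ 𝔊.fields)
    (hdom : (dom (operatorIntegral 𝔊 μ A)).Nonempty) :
    IsMaximallyMonotone (operatorIntegral 𝔊 μ A) := by
  refine isMaximallyMonotone_of_surjective
    (isMonotone_operatorIntegral fun ω => (hA ω).1) fun x => ?_
  obtain ⟨z, w, hw⟩ := hdom
  choose p hp using fun ω => (hA ω).resolvent_nonempty (x ω)
  have hx := Space.coeFn_mem x
  have hz := Space.coeFn_mem z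
  have hpf := hJ _ hx p hp
  have hd := Submodule.sub_mem _ hx (Submodule.add_mem _ hz (Space.coeFn_mem w))
  -- The measure may be infinite and `0` need not be in the domain, so `p` is compared with `z`:
  -- almost everywhere `p - z` is dominated by `x - (z + w)`.
  have hpz : p - (fun ω => z ω) ∈ squareIntegrable 𝔊 μ := by
    have hf := 𝔊.fields.sub_mem hpf hz.1
    refine ⟨hf, (memLp_norm_iff 𝔊 μ hf).1 (((memLp_norm_iff 𝔊 μ hd.1).2 hd.2).mono
      (𝔊.measurable_norm _ hf).aestronglyMeasurable ?_)⟩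
    filter_upwards [hw] with ω hω
    rw [norm_norm, norm_norm]
    exact (hA ω).1.norm_resolvent_sub_le (hp ω) hω
  have hps : p ∈ squareIntegrable 𝔊 μ := by
    simpa using Submodule.add_mem _ hpz hz
  have hxp : x = Space.mk ⟨p, hps⟩ + (x - Space.mk ⟨p, hps⟩) := by abel
  refine ⟨Space.mk ⟨p, hps⟩, x - Space.mk ⟨p, hps⟩, ?_, hxp⟩
  filter_upwards [Space.coeFn_sub x (Space.mk ⟨p, hps⟩), Space.coeFn_mk ⟨p, hps⟩] with ω h1 h2
  rw [h1, h2]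
  obtain ⟨v, hv, hxv⟩ := hp ω
  -- Both `x ω - p ω` and `v` give `x ω` when added to `p ω`, so they agree.
  rwa [eq_add_of_sub_eq' rfl |>.symm.trans hxv |> add_left_cancel]

/-! ### Kuhn–Tucker and saddle operators. -/

variable {G : Type*} [NormedAddCommGroup G] [InnerProductSpace ℝ G]
  {L : ∀ ω, G →L[ℝ] H ω} {hL : ∀ z, (fun ω => L ω z) ∈ 𝔊.fields}
  {hL2 : ∫⁻ ω, ‖L ω‖ₑ ^ 2 ∂μ < ∞} {W : G → Set G} {A : ∀ ω, H ω → Set (H ω)}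

theorem coeFn_evaluation (z : G) : ∀ᵐ ω ∂μ, evaluation L hL hL2 z ω = L ω z :=
  Space.coeFn_mk _

variable [CompleteSpace G] [∀ ω, CompleteSpace (H ω)]

theorem mem_zer_kuhnTucker_iff {z : G} {x : Space 𝔊 μ} :
    WithLp.toLp 2 (z, x) ∈ zer (kuhnTucker W A L hL hL2) ↔
      -adjointIntegral L x ∈ W z ∧ ∀ᵐ ω ∂μ, x ω ∈ A ω (L ω z) := by
  have hev := coeFn_evaluation (hL := hL) (hL2 := hL2) z
  constructor
  · rintro ⟨⟨w, hw, h1⟩, u, hu, h2⟩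
    change 0 = w + adjointIntegral L x at h1
    change 0 = -evaluation L hL hL2 z + u at h2
    rw [← eq_neg_of_add_eq_zero_left h1.symm]
    refine ⟨hw, ?_⟩
    rw [← neg_add_eq_zero.1 h2.symm] at hu
    filter_upwards [hu, hev] with ω h3 h4
    rw [← h4]
    exact h3
  · rintro ⟨h1, h2⟩
    refine ⟨⟨_, h1, (neg_add_cancel _).symm⟩, evaluation L hL hL2 z, ?_, (neg_add_cancel _).symm⟩
    filter_upwards [h2, hev] with ω h3 h4
    change x ω ∈ A ω (evaluation L hL hL2 z ω)
    rwa [h4]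

/-- The last row forces `x` to be the evaluation of `z`; eliminating it leaves the Kuhn–Tucker
system. -/
theorem mem_zer_saddle_iff {z : G} {x u : Space 𝔊 μ} :
    WithLp.toLp 2 (z, WithLp.toLp 2 (x, u)) ∈ zer (saddle W A L hL hL2) ↔
      WithLp.toLp 2 (z, u) ∈ zer (kuhnTucker W A L hL hL2) ∧ x = evaluation L hL hL2 z := by
  constructor
  · rintro ⟨h1, ⟨v, hv, h2⟩, h3⟩
    change 0 = v - u at h2
    change 0 = -evaluation L hL hL2 z + x at h3
    obtain rfl := sub_eq_zero.1 h2.symm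
    obtain rfl := neg_add_eq_zero.1 h3.symm
    exact ⟨⟨h1, _, hv, (neg_add_cancel _).symm⟩, rfl⟩
  · rintro ⟨⟨h1, v, hv, h2⟩, rfl⟩
    change 0 = -evaluation L hL hL2 z + v at h2
    obtain rfl := neg_add_eq_zero.1 h2.symm
    exact ⟨h1, ⟨u, hv, (sub_self _).symm⟩, (neg_add_cancel _).symm⟩

variable [TopologicalSpace.SeparableSpace G]

/-- Integrability lets the scalar product pass under the integral, where the fibrewise adjoint
relation applies. This makes the coupling terms skew. -/
theorem inner_adjointIntegral (z : G) (x : Space 𝔊 μ) :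
    ⟪z, adjointIntegral L x⟫_ℝ = ⟪evaluation L hL hL2 z, x⟫_ℝ := by
  rw [adjointIntegral, ← integral_inner (integrable_adjoint L hL hL2 x), Space.real_inner_eq]
  refine integral_congr_ae ?_
  filter_upwards [coeFn_evaluation (hL := hL) (hL2 := hL2) z] with ω h
  rw [h, ContinuousLinearMap.adjoint_inner_right]

theorem isMaximallyMonotone_kuhnTucker (hW : IsMaximallyMonotone W)
    (hA : IsMaximallyMonotone (operatorIntegral 𝔊 μ A)) :
    IsMaximallyMonotone (kuhnTucker W A L hL hL2) := by
  -- The inverse of the operator integral is, by unfolding, the integral of the fibrewise inverses.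
  have h := (hW.prod hA.inverse).add_skew
    (fun p => WithLp.toLp 2 (adjointIntegral L p.snd, -evaluation L hL hL2 p.fst)) fun p q => by
      simp only [WithLp.prod_inner_apply, WithLp.fst, WithLp.snd,
        inner_sub_left, inner_sub_right, inner_neg_right]
      simp only [inner_adjointIntegral (hL := hL) (hL2 := hL2),
        real_inner_comm (evaluation L hL hL2 _)]
      ring
  convert h using 1
  funext p
  ext q
  constructor
  · rintro ⟨⟨w, hw, h1⟩, u, hu, h2⟩
    refine ⟨?_, ?_⟩
    · change q.fst - adjointIntegral L p.snd ∈ W p.fst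
      rwa [h1, add_sub_cancel_right]
    · change q.snd - -evaluation L hL hL2 p.fst ∈
        operatorIntegral 𝔊 μ (fun ω => inverse (A ω)) p.snd
      rwa [h2, add_sub_cancel_left]
  · rintro ⟨h1, h2⟩
    exact ⟨⟨_, h1, (sub_add_cancel _ _).symm⟩, _, h2, (add_sub_cancel _ _).symm⟩

theorem isMaximallyMonotone_saddle (hW : IsMaximallyMonotone W)
    (hA : IsMaximallyMonotone (operatorIntegral 𝔊 μ A)) :
    IsMaximallyMonotone (saddle W A L hL hL2) := by
  have h := (hW.prod (hA.prod (isMaximallyMonotone_zero (E := Space 𝔊 μ)))).add_skew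
    (fun p => WithLp.toLp 2 (adjointIntegral L p.snd.snd,
      WithLp.toLp 2 (-p.snd.snd, -evaluation L hL hL2 p.fst + p.snd.fst))) fun p q => by
      simp only [WithLp.prod_inner_apply, WithLp.fst, WithLp.snd,
        inner_sub_left, inner_sub_right, inner_neg_right, inner_add_right]
      simp only [inner_adjointIntegral (hL := hL) (hL2 := hL2),
        real_inner_comm (evaluation L hL hL2 _)]
      simp only [real_inner_comm p.ofLp.2.ofLp.2, real_inner_comm q.ofLp.2.ofLp.2]
      ring
  convert h using 1
  funext p
  ext q
  constructor
  · rintro ⟨⟨w, hw, h1⟩, ⟨u, hu, h2⟩, h3⟩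
    refine ⟨?_, ?_, ?_⟩
    · change q.fst - adjointIntegral L p.snd.snd ∈ W p.fst
      rwa [h1, add_sub_cancel_right]
    · change q.snd.fst - -p.snd.snd ∈ operatorIntegral 𝔊 μ A p.snd.fst
      rwa [h2, sub_neg_eq_add, sub_add_cancel]
    · exact sub_eq_zero.2 h3
  · rintro ⟨h1, h2, h3⟩
    refine ⟨⟨_, h1, (sub_add_cancel _ _).symm⟩, ⟨_, h2, ?_⟩, sub_eq_zero.1 h3⟩
    change q.snd.fst = q.snd.fst - -p.snd.snd - p.snd.snd
    abel

theorem mem_primalSolutions (hL : ∀ z, (fun ω => L ω z) ∈ 𝔊.fields)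
    (hL2 : ∫⁻ ω, ‖L ω‖ₑ ^ 2 ∂μ < ∞) {z : G} {x : Space 𝔊 μ} (h1 : -adjointIntegral L x ∈ W z)
    (h2 : ∀ᵐ ω ∂μ, x ω ∈ A ω (L ω z)) : z ∈ primalSolutions μ W A L := by
  refine ⟨_, h1, adjointIntegral L x, ⟨_, integrable_adjoint L hL hL2 x, ?_, rfl⟩,
    (neg_add_cancel _).symm⟩
  filter_upwards [h2] with ω h
  exact ⟨_, h, rfl⟩

end Fields

end DirectIntegral

/-! ### The main theorem. -/

theorem theoremt {Ω : Type*} [MeasurableSpace Ω] (μ : Measure Ω) [μ.IsComplete] [SigmaFinite μ]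
    {H : Ω → Type*} [∀ ω, NormedAddCommGroup (H ω)] [∀ ω, InnerProductSpace ℝ (H ω)]
    [∀ ω, CompleteSpace (H ω)] (𝔊 : DirectIntegral.MeasurableField H)
    (A : ∀ ω, H ω → Set (H ω))
    (hA : ∀ ω, DirectIntegral.IsMaximallyMonotone (A ω))
    (hJ : ∀ x ∈ DirectIntegral.squareIntegrable 𝔊 μ, ∀ p : ∀ ω, H ω,
      (∀ ω, p ω ∈ DirectIntegral.resolvent (A ω) (x ω)) → p ∈ 𝔊.fields)
    (hdom : (DirectIntegral.dom (DirectIntegral.operatorIntegral 𝔊 μ A)).Nonempty)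
    {G : Type*} [NormedAddCommGroup G] [InnerProductSpace ℝ G] [CompleteSpace G]
    [TopologicalSpace.SeparableSpace G]
    (L : ∀ ω, G →L[ℝ] H ω) (hL : ∀ z, (fun ω => L ω z) ∈ 𝔊.fields)
    (hL2 : ∫⁻ ω, ‖L ω‖ₑ ^ 2 ∂μ < ∞)
    (W : G → Set G) (hW : DirectIntegral.IsMaximallyMonotone W) :
    (DirectIntegral.IsMaximallyMonotone (DirectIntegral.kuhnTucker W A L hL hL2) ∧
      DirectIntegral.IsMaximallyMonotone (DirectIntegral.saddle W A L hL hL2)) ∧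
    ((IsClosed (DirectIntegral.zer (DirectIntegral.kuhnTucker W A L hL hL2)) ∧
        Convex ℝ (DirectIntegral.zer (DirectIntegral.kuhnTucker W A L hL hL2))) ∧
      IsClosed (DirectIntegral.zer (DirectIntegral.saddle W A L hL hL2)) ∧
        Convex ℝ (DirectIntegral.zer (DirectIntegral.saddle W A L hL hL2))) ∧
    (∀ (z : G) (x : DirectIntegral.Space 𝔊 μ),
      WithLp.toLp 2 (z, x) ∈ DirectIntegral.zer (DirectIntegral.kuhnTucker W A L hL hL2) →
        z ∈ DirectIntegral.primalSolutions μ W A L ∧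
          x ∈ DirectIntegral.dualSolutions 𝔊 μ W A L) ∧
    (∀ (z : G) (x u : DirectIntegral.Space 𝔊 μ),
      WithLp.toLp 2 (z, WithLp.toLp 2 (x, u)) ∈
          DirectIntegral.zer (DirectIntegral.saddle W A L hL hL2) →
        z ∈ DirectIntegral.primalSolutions μ W A L ∧
          u ∈ DirectIntegral.dualSolutions 𝔊 μ W A L) ∧
    ((DirectIntegral.zer (DirectIntegral.saddle W A L hL hL2)).Nonempty ↔
      (DirectIntegral.zer (DirectIntegral.kuhnTucker W A L hL hL2)).Nonempty) ∧
    ((DirectIntegral.zer (DirectIntegral.kuhnTucker W A L hL hL2)).Nonempty ↔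
      (DirectIntegral.dualSolutions 𝔊 μ W A L).Nonempty) ∧
    ((DirectIntegral.dualSolutions 𝔊 μ W A L).Nonempty →
      (DirectIntegral.primalSolutions μ W A L).Nonempty) := by
  have hAm := DirectIntegral.isMaximallyMonotone_operatorIntegral hA hJ hdom
  have hK := DirectIntegral.isMaximallyMonotone_kuhnTucker (L := L) (hL := hL) (hL2 := hL2) hW hAm
  have hS := DirectIntegral.isMaximallyMonotone_saddle (L := L) (hL := hL) (hL2 := hL2) hW hAm
  have hsol : ∀ (z : G) (x : DirectIntegral.Space 𝔊 μ),
      WithLp.toLp 2 (z, x) ∈ DirectIntegral.zer (DirectIntegral.kuhnTucker W A L hL hL2) →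
        z ∈ DirectIntegral.primalSolutions μ W A L ∧
          x ∈ DirectIntegral.dualSolutions 𝔊 μ W A L := by
    intro z x h
    obtain ⟨h1, h2⟩ := DirectIntegral.mem_zer_kuhnTucker_iff.1 h
    exact ⟨DirectIntegral.mem_primalSolutions hL hL2 h1 h2, z, h1, h2⟩
  refine ⟨⟨hK, hS⟩, ⟨⟨hK.isClosed_zer, hK.convex_zer⟩, hS.isClosed_zer, hS.convex_zer⟩, hsol,
    fun z x u h => hsol z u (DirectIntegral.mem_zer_saddle_iff.1 h).1, ⟨?_, ?_⟩, ⟨?_, ?_⟩, ?_⟩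
  · rintro ⟨p, hp⟩
    exact ⟨_, (DirectIntegral.mem_zer_saddle_iff.1 hp).1⟩
  · rintro ⟨p, hp⟩
    -- The `rfl` fixes the middle component of the saddle point as the evaluation of `p.fst`.
    exact ⟨_, DirectIntegral.mem_zer_saddle_iff.2 ⟨hp, rfl⟩⟩
  · rintro ⟨p, hp⟩
    exact ⟨_, (hsol p.fst p.snd hp).2⟩
  · rintro ⟨x, z, h1, h2⟩
    exact ⟨_, DirectIntegral.mem_zer_kuhnTucker_iff.2 ⟨h1, h2⟩⟩
  · rintro ⟨x, z, h1, h2⟩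
    exact ⟨z, DirectIntegral.mem_primalSolutions hL hL2 h1 h2⟩
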